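/- Proposition 3. A (not necessarily normalized) product state in $\mathbb{C}^m\otimes\mathbb{C}^n$ is a nonzero vector of the form $a\otimes b$. An unextendible product basis (UPB) in $\mathbb{C}^m\otimes\mathbb{C}^n$ is a finite set of pairwise orthogonal product states that spans a proper subspace of $\mathbb{C}^m\otimes\mathbb{C}^n$ whose orthogonal complement contains no product state; its size is its number of elements. Then: (i) for all integers $m,n,k$ with $4\le m\le n$ and $4\le k\le 2m-1$ there is a UPB of size $mn-k$ in $\mathbb{C}^m\otimes\mathbb{C}^n$; (ii) for all integers $3\le m\le n$, $F(m,n)=mn-4$, where $F(m,n)$ is the maximum size of a UPB in $\mathbb{C}^m\otimes\mathbb{C}^n$ (that is, a UPB of size $mn-4$ exists, and every UPB has size at most $mn-4$). -/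

import Mathlib

open scoped TensorProduct InnerProductSpace

/-- The bipartite Hilbert space `ℂ^m ⊗ ℂ^n`, with its standard inner product. -/
abbrev BipartiteSpace (m n : ℕ) : Type :=
  EuclideanSpace ℂ (Fin m) ⊗[ℂ] EuclideanSpace ℂ (Fin n)

/-- A (not necessarily normalized) product state: a nonzero vector of the form `a ⊗ b`. -/
def IsProductState {m n : ℕ} (ψ : BipartiteSpace m n) : Prop :=
  ψ ≠ 0 ∧ ∃ (a : EuclideanSpace ℂ (Fin m)) (b : EuclideanSpace ℂ (Fin n)), ψ = a ⊗ₜ[ℂ] b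

/-- An unextendible product basis (UPB) of `ℂ^m ⊗ ℂ^n`: a set of pairwise orthogonal product
states that spans a proper subspace, whose orthogonal complement contains no product state. -/
structure IsUPB {m n : ℕ} (U : Finset (BipartiteSpace m n)) : Prop where
  product : ∀ ψ ∈ U, IsProductState ψ
  orthogonal : ∀ ψ ∈ U, ∀ φ ∈ U, ψ ≠ φ → ⟪ψ, φ⟫_ℂ = 0
  incomplete : Submodule.span ℂ (U : Set (BipartiteSpace m n)) ≠ ⊤
  unextendible : ∀ φ ∈ (Submodule.span ℂ (U : Set (BipartiteSpace m n)))ᗮ, ¬ IsProductState φ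

/-- The set of all sizes of UPBs in `ℂ^m ⊗ ℂ^n`; its greatest element is `F(m,n)`. -/
def upbSizes (m n : ℕ) : Set ℕ :=
  {s | ∃ U : Finset (BipartiteSpace m n), IsUPB U ∧ U.card = s}

/-! Upper bound. Let `W` be the orthogonal complement of an orthogonal set of product states, and
let `S a f` be the projection of `a ⊗ f` to `W`. The projector onto `W` has positive partial
transpose: conjugating the first factors keeps normalized orthogonal products orthonormal, so the
partial transpose is again a projector. If `1 ≤ dim W ≤ 3`, this forces a product vector in `W`
(`IsPPT.hasProductVector_of_finrank_le_three`). When some slice of `S` is onto `W`, the remaining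
slices become commuting normal operators and a common eigenvector of their adjoints is the product
vector; otherwise all slices have rank at most two and the vector is found by a dimension count. So
a UPB leaves a complement of dimension at least 4.

Existence. Partition some rows of the `m × n` grid into tiles, each inside a row or a column. The
zero-sum vectors on the tiles and the basis vectors of the untiled rows have orthogonal product
bases, and the sum of all tiled cells is one more product state. With `T` tiles the complement has
dimension `T - 1`, and unextendibility says that no nonzero product vector constant on tiles and
zero elsewhere has coordinate sum zero (`exists_isUPBFor_of_tiling`). Vertical dominoes along the
edges of a star or of a cycle on `p` rows, with the rest of each row as one tile, give `T = 2p - 1`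
and `T = 2p`: the even and the odd values of `k`. -/

/-! ### Positive partial transpose and commuting normal operators -/

section PartialTranspose

variable {A B V : Type*} [AddCommGroup A] [Module ℂ A] [AddCommGroup B] [Module ℂ B]
  [NormedAddCommGroup V] [InnerProductSpace ℂ V]

/-- Positivity of the partial transpose of the Gram matrix of the vectors `S a f`, restricted to
two-dimensional subspaces of `A`. -/
def IsPPT (S : A →ₗ[ℂ] B →ₗ[ℂ] V) : Prop :=
  ∀ (a c : A) (f g : B), 0 ≤ ‖S a f‖ ^ 2 + ‖S c g‖ ^ 2 + 2 * (⟪S c f, S a g⟫_ℂ).re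

lemma IsPPT.flip {S : A →ₗ[ℂ] B →ₗ[ℂ] V} (hS : IsPPT S) : IsPPT S.flip := by
  intro a c f g
  have h := hS f g a c
  rw [← inner_conj_symm, Complex.conj_re] at h
  simpa using h

/-- Rescaling `f` leaves the two square terms fixed and moves the cross term linearly, so
nonnegativity kills the cross term. -/
lemma IsPPT.inner_eq_zero {S : A →ₗ[ℂ] B →ₗ[ℂ] V} (hS : IsPPT S) {a : A} {f : B}
    (h : S a f = 0) (c : A) (g : B) : ⟪S c f, S a g⟫_ℂ = 0 := by
  by_contra hz
  set z := ⟪S c f, S a g⟫_ℂ with hzdef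
  have hpos : 0 < Complex.normSq z := Complex.normSq_pos.2 hz
  set s : ℝ := (‖S c g‖ ^ 2 + 1) / Complex.normSq z with hs
  have key := hS a c (((-s : ℝ) : ℂ) • z • f) g
  have h1 : ⟪S c (((-s : ℝ) : ℂ) • z • f), S a g⟫_ℂ = ((-s * Complex.normSq z : ℝ) : ℂ) := by
    rw [map_smul, map_smul, inner_smul_left, inner_smul_left, ← hzdef, Complex.conj_ofReal,
      ← Complex.normSq_eq_conj_mul_self]
    push_cast; ring
  rw [h1, Complex.ofReal_re] at key
  have h2 : s * Complex.normSq z = ‖S c g‖ ^ 2 + 1 := by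
    rw [hs]; field_simp
  simp only [map_smul, h, smul_zero, norm_zero] at key
  nlinarith [sq_nonneg ‖S c g‖]

variable [FiniteDimensional ℂ V]

/-- The self-commutator `N* N - N N*` is positive by hypothesis and has trace zero, hence vanishes.
-/
lemma LinearMap.adjoint_comp_self_eq_of_norm_adjoint_le (N : V →ₗ[ℂ] V)
    (h : ∀ y, ‖N.adjoint y‖ ≤ ‖N y‖) : N.adjoint ∘ₗ N = N ∘ₗ N.adjoint := by
  set T : V →ₗ[ℂ] V := N.adjoint ∘ₗ N - N ∘ₗ N.adjoint with hT
  have hsymm : T.IsSymmetric := by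
    intro x y
    simp only [hT, LinearMap.sub_apply, LinearMap.comp_apply, inner_sub_left, inner_sub_right]
    rw [LinearMap.adjoint_inner_left, LinearMap.adjoint_inner_right,
      ← LinearMap.adjoint_inner_right N (N.adjoint x) y, ← LinearMap.adjoint_inner_left N _ x]
  have hpos : T.IsPositive := by
    refine ⟨hsymm, fun x => ?_⟩
    have h1 : ⟪T x, x⟫_ℂ = ((‖N x‖ ^ 2 - ‖N.adjoint x‖ ^ 2 : ℝ) : ℂ) := by
      simp only [hT, LinearMap.sub_apply, LinearMap.comp_apply, inner_sub_left]
      rw [LinearMap.adjoint_inner_left, ← LinearMap.adjoint_inner_right N (N.adjoint x) x,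
        inner_self_eq_norm_sq_to_K, inner_self_eq_norm_sq_to_K]
      push_cast; rfl
    rw [h1]
    simp only [RCLike.re_to_complex, Complex.ofReal_re, sub_nonneg]
    gcongr
    exact h x
  have htr : LinearMap.trace ℂ V T = 0 := by
    rw [hT, map_sub, LinearMap.trace_comp_comm', sub_self]
  have hsum := hsymm.re_trace_eq_sum_eigenvalues rfl
  rw [htr, map_zero, eq_comm, Finset.sum_eq_zero_iff_of_nonneg
    (fun i _ => hpos.nonneg_eigenvalues rfl i)] at hsum
  have hzero : T = 0 := by
    refine (hsymm.eigenvectorBasis rfl).toBasis.ext fun i => ?_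
    simp [hsymm.apply_eigenvectorBasis, hsum i (Finset.mem_univ i)]
  exact sub_eq_zero.1 hzero

/-- In a minimal nonzero invariant subspace, any eigenspace of `T i` is again invariant, so it is
everything and each `T i` acts there as a scalar. -/
lemma exists_common_eigenvector {ι : Type*} [Nontrivial V] (T : ι → V →ₗ[ℂ] V)
    (hT : ∀ i j x, T i (T j x) = T j (T i x)) :
    ∃ x : V, x ≠ 0 ∧ ∀ i, ∃ μ : ℂ, T i x = μ • x := by
  have hne : {d : ℕ | ∃ W : Submodule ℂ V, W ≠ ⊥ ∧ (∀ i, ∀ x ∈ W, T i x ∈ W) ∧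
      Module.finrank ℂ W = d}.Nonempty :=
    ⟨_, ⊤, top_ne_bot, fun _ _ _ => trivial, rfl⟩
  obtain ⟨W, hW, hinv, hd⟩ := WellFounded.min_mem Nat.lt_wfRel.wf _ hne
  have hmin : ∀ W' : Submodule ℂ V, W' ≠ ⊥ → (∀ i, ∀ x ∈ W', T i x ∈ W') → W' ≤ W → W' = W := by
    intro W' h1 h2 h3
    refine Submodule.eq_of_le_of_finrank_le h3 ?_
    rw [hd]
    refine not_lt.1 (WellFounded.not_lt_min Nat.lt_wfRel.wf _ ?_)
    exact ⟨W', h1, h2, rfl⟩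
  obtain ⟨x, hxW, hx⟩ := Submodule.exists_mem_ne_zero_of_ne_bot hW
  refine ⟨x, hx, fun i => ?_⟩
  have : Nontrivial W := ⟨⟨x, hxW⟩, 0, by simpa [Subtype.ext_iff] using hx⟩
  obtain ⟨μ, hμ⟩ := Module.End.exists_eigenvalue ((T i).restrict (hinv i))
  obtain ⟨y, hy⟩ := hμ.exists_hasEigenvector
  have hy1 : T i y = μ • (y : V) := congrArg Subtype.val hy.apply_eq_smul
  refine ⟨μ, ?_⟩
  have hE := hmin (W ⊓ LinearMap.ker (T i - μ • LinearMap.id)) ?_ ?_ inf_le_left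
  · rw [← hE] at hxW
    simpa [sub_eq_zero] using hxW.2
  · refine Submodule.ne_bot_iff _ |>.2 ⟨y, ⟨y.2, ?_⟩, ?_⟩
    · simp [hy1]
    · simpa using hy.2
  · rintro j z ⟨hz, hz'⟩
    refine ⟨hinv j z hz, ?_⟩
    have hz'' : T i z = μ • z := by simpa [sub_eq_zero] using hz'
    simp [hT i j, hz'']

/-- Polarizing normality of the pencil gives `M* N = N M*`; Fuglede's theorem then replaces `M*` by
`M`. -/
lemma commute_of_forall_adjoint_comp_eq {N M : V →ₗ[ℂ] V}
    (h : ∀ z w : ℂ, (z • N + w • M).adjoint ∘ₗ (z • N + w • M) =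
      (z • N + w • M) ∘ₗ (z • N + w • M).adjoint) :
    N ∘ₗ M = M ∘ₗ N := by
  have hM : M.adjoint ∘ₗ M = M ∘ₗ M.adjoint := by simpa using h 0 1
  have hN : N.adjoint ∘ₗ N = N ∘ₗ N.adjoint := by simpa using h 1 0
  have h1 := h 1 1
  have h2 := h 1 Complex.I
  simp only [map_add, one_smul, LinearMap.add_comp, LinearMap.comp_add, LinearEquiv.map_smulₛₗ,
    LinearMap.smul_comp, LinearMap.comp_smul, hM, hN, Complex.conj_I] at h1 h2
  have hc : M.adjoint ∘ₗ N = N ∘ₗ M.adjoint := by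
    have e1 : N.adjoint ∘ₗ M + M.adjoint ∘ₗ N = M ∘ₗ N.adjoint + N ∘ₗ M.adjoint := by
      linear_combination (norm := module) h1
    have e2 : Complex.I • (N.adjoint ∘ₗ M) - Complex.I • (M.adjoint ∘ₗ N) =
        Complex.I • (M ∘ₗ N.adjoint) - Complex.I • (N ∘ₗ M.adjoint) := by
      linear_combination (norm := module) h2
    have e3 : N.adjoint ∘ₗ M - M.adjoint ∘ₗ N = M ∘ₗ N.adjoint - N ∘ₗ M.adjoint := by
      have := congrArg (fun X => (-Complex.I) • X) e2
      simpa [smul_sub, smul_smul] using this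
    have e4 : (2 : ℂ) • (M.adjoint ∘ₗ N) = (2 : ℂ) • (N ∘ₗ M.adjoint) := by
      rw [two_smul, two_smul]
      linear_combination (norm := module) e1 - e3
    exact smul_right_injective _ (two_ne_zero) e4
  let e := LinearMap.toContinuousLinearMap (E := V) (F' := V) (𝕜 := ℂ)
  have hadj : ∀ X : V →ₗ[ℂ] V, star (e X) = e X.adjoint := by
    intro X
    rw [ContinuousLinearMap.star_eq_adjoint]
    rfl
  have hn : IsStarNormal (star (e M)) := by
    constructor
    rw [star_star, hadj]
    ext x
    exact (LinearMap.congr_fun hM x).symm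
  have hcc : Commute (star (e M)) (e N) := by
    rw [hadj]
    ext x
    exact LinearMap.congr_fun hc x
  have := hn.commute_star_left hcc
  rw [star_star] at this
  ext x
  exact (congrArg (fun X : V →L[ℂ] V => X x) this).symm

end PartialTranspose

/-! ### Product vectors in PPT forms of rank at most three -/

section ProductVector

variable {A B V : Type*} [AddCommGroup A] [Module ℂ A] [AddCommGroup B] [Module ℂ B]
  [NormedAddCommGroup V] [InnerProductSpace ℂ V]

/-- The pairing of some nonzero vector with the bilinear map `S` has rank at most one. -/
def HasProductVector (S : A →ₗ[ℂ] B →ₗ[ℂ] V) : Prop :=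
  ∃ x : V, x ≠ 0 ∧ ∃ (φ : A →ₗ[ℂ] ℂ) (ψ : B →ₗ[ℂ] ℂ), ∀ a f, ⟪x, S a f⟫_ℂ = φ a * ψ f

lemma HasProductVector.of_flip {S : A →ₗ[ℂ] B →ₗ[ℂ] V} (h : HasProductVector S.flip) :
    HasProductVector S := by
  obtain ⟨x, hx, φ, ψ, h⟩ := h
  exact ⟨x, hx, ψ, φ, fun a f => by rw [mul_comm, ← h]; rfl⟩

/-- The bilinear map `(a, f) ↦ ⟪x, S a f⟫`. -/
noncomputable def pairing (S : A →ₗ[ℂ] B →ₗ[ℂ] V) (x : V) : A →ₗ[ℂ] B →ₗ[ℂ] ℂ :=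
  S.compr₂ (innerₛₗ ℂ x)

lemma pairing_apply (S : A →ₗ[ℂ] B →ₗ[ℂ] V) (x : V) (a : A) (f : B) :
    pairing S x a f = ⟪x, S a f⟫_ℂ := rfl

variable [FiniteDimensional ℂ V]

/-- Each slice factors as `S c = N c ∘ S a`. Positivity makes every `N c` normal, and linearity in
`c` makes them commute; a common eigenvector of the adjoints pairs with all slices proportionally.
-/
theorem IsPPT.hasProductVector_of_surjective [Nontrivial V] {S : A →ₗ[ℂ] B →ₗ[ℂ] V}
    (hS : IsPPT S) {a : A} (ha : Function.Surjective (S a)) : HasProductVector S := by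
  obtain ⟨s, hs⟩ := (S a).exists_rightInverse_of_surjective (LinearMap.range_eq_top.2 ha)
  have hs' : ∀ x, S a (s x) = x := fun x => LinearMap.congr_fun hs x
  let N : A →ₗ[ℂ] V →ₗ[ℂ] V := S.compl₂ s
  have hNdef : ∀ c x, N c x = S c (s x) := fun c x => rfl
  have hker : ∀ f, S a f = 0 → ∀ c, S c f = 0 := by
    intro f hf c
    obtain ⟨g, hg⟩ := ha (S c f)
    have := hS.inner_eq_zero hf c g
    rwa [hg, inner_self_eq_zero] at this
  have hfac : ∀ c f, S c f = N c (S a f) := by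
    intro c f
    have := hker (f - s (S a f)) (by simp [hs']) c
    rw [map_sub, sub_eq_zero] at this
    exact this
  have hhyp : ∀ c y, ‖(N c).adjoint y‖ ≤ ‖N c y‖ := by
    intro c y
    -- With these arguments the cross term is `-2‖(N c)* y‖²`, outweighing the square `‖(N c)* y‖²`.
    have h := hS a c (s (-(N c).adjoint y)) (s y)
    rw [hs', hs', ← hNdef, ← hNdef, map_neg, inner_neg_left, ← LinearMap.adjoint_inner_right,
      inner_self_eq_norm_sq_to_K, norm_neg, Complex.neg_re] at h
    have h2 : (((‖(N c).adjoint y‖ : ℝ) : ℂ) ^ 2).re = ‖(N c).adjoint y‖ ^ 2 := by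
      rw [← Complex.ofReal_pow, Complex.ofReal_re]
    rw [show ((RCLike.ofReal ‖(N c).adjoint y‖ : ℂ)) = ((‖(N c).adjoint y‖ : ℝ) : ℂ) from rfl,
      h2] at h
    exact le_of_sq_le_sq (by linarith) (norm_nonneg _)
  have hcomm : ∀ c d, N c ∘ₗ N d = N d ∘ₗ N c := by
    intro c d
    refine commute_of_forall_adjoint_comp_eq fun z w => ?_
    have : z • N c + w • N d = N (z • c + w • d) := by simp
    rw [this]
    exact LinearMap.adjoint_comp_self_eq_of_norm_adjoint_le _ (hhyp _)
  obtain ⟨x, hx, hμ⟩ := exists_common_eigenvector (fun c => (N c).adjoint) (by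
    intro c d x
    have := congrArg LinearMap.adjoint (hcomm d c)
    rw [LinearMap.adjoint_comp, LinearMap.adjoint_comp] at this
    exact LinearMap.congr_fun this x)
  refine ⟨x, hx, ?_⟩
  have hpair : ∀ c, ∃ μ : ℂ, ∀ f, ⟪x, S c f⟫_ℂ = μ * ⟪x, S a f⟫_ℂ := by
    intro c
    obtain ⟨μ, h⟩ := hμ c
    refine ⟨starRingEnd ℂ μ, fun f => ?_⟩
    rw [hfac, ← LinearMap.adjoint_inner_left]
    change ⟪(N c).adjoint x, _⟫_ℂ = _
    rw [show (N c).adjoint x = μ • x from h, inner_smul_left]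
  obtain ⟨g, hg⟩ := ha x
  refine ⟨(⟪x, x⟫_ℂ)⁻¹ • (pairing S x).flip g, pairing S x a, fun c f => ?_⟩
  obtain ⟨μ, h⟩ := hpair c
  have hxx : ⟪x, x⟫_ℂ ≠ 0 := inner_self_ne_zero.2 hx
  rw [LinearMap.smul_apply, LinearMap.flip_apply, pairing_apply, pairing_apply, h, h, hg,
    smul_eq_mul]
  field_simp

/-- If `S a f = 0` but `S c f ≠ 0`, then `S c f` is orthogonal to the range of `S a`, and a small
perturbation `a + t • c` has larger rank, against maximality. -/
lemma IsPPT.ker_le_ker {S : A →ₗ[ℂ] B →ₗ[ℂ] V} (hS : IsPPT S) {a : A}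
    (ha : ∀ c, Module.finrank ℂ (S c).range ≤ Module.finrank ℂ (S a).range) (c : A) :
    (S a).ker ≤ (S c).ker := by
  intro f hf
  rw [LinearMap.mem_ker] at hf ⊢
  by_contra hcf
  set r := Module.finrank ℂ (S a).range with hr
  let b := stdOrthonormalBasis ℂ (S a).range
  choose g hg using fun i => LinearMap.mem_range.1 (b i).2
  have hon : LinearIndependent ℂ (fun o : Option (Fin r) => o.elim (S c f) (fun i => S a (g i))) := by
    refine linearIndependent_of_ne_zero_of_inner_eq_zero ?_ ?_
    · rintro (_ | i)
      · exact hcf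
      · simpa [hg] using b.orthonormal.ne_zero i
    · rintro (_ | i) (_ | j) hij
      · exact absurd rfl hij
      · exact hS.inner_eq_zero hf c _
      · rw [← inner_conj_symm, map_eq_zero]
        exact hS.inner_eq_zero hf c _
      · have hij' : i ≠ j := fun h => hij (congrArg some h)
        simpa [hg] using b.orthonormal.2 hij'
  let F : ℂ → Option (Fin r) → V := fun t o => o.elim (S c f) (fun i => S a (g i) + t • S c (g i))
  have hF : Continuous F := by
    refine continuous_pi ?_
    rintro (_ | i) <;> simp only [F, Option.elim] <;> fun_prop
  have hF0 : F 0 = fun o : Option (Fin r) => o.elim (S c f) (fun i => S a (g i)) := by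
    ext (_ | i) <;> simp [F]
  have hopen := (isOpen_setOfPred_linearIndependent (𝕜 := ℂ) (E := V) (ι := Option (Fin r))).preimage hF
  have hmem : (0 : ℂ) ∈ F ⁻¹' {f | LinearIndependent ℂ f} := by
    change LinearIndependent ℂ (F 0)
    rw [hF0]; exact hon
  obtain ⟨ε, hε, hball⟩ := Metric.isOpen_iff.1 hopen 0 hmem
  set t : ℂ := ((ε / 2 : ℝ) : ℂ) with ht
  have ht0 : t ≠ 0 := by rw [ht]; exact_mod_cast (half_pos hε).ne'
  have hli : LinearIndependent ℂ (F t) := by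
    refine hball ?_
    rw [mem_ball_zero_iff, ht, Complex.norm_real, Real.norm_of_nonneg (half_pos hε).le]
    exact half_lt_self hε
  have hrange : ∀ o, F t o ∈ (S (a + t • c)).range := by
    rintro (_ | i)
    · exact ⟨t⁻¹ • f, by simp [F, hf, smul_smul, ht0]⟩
    · exact ⟨g i, by simp [F]⟩
  have hli' : LinearIndependent ℂ (fun o => (⟨F t o, hrange o⟩ : (S (a + t • c)).range)) :=
    LinearIndependent.of_comp (S (a + t • c)).range.subtype hli
  have hcard := hli'.fintype_card_le_finrank
  have := ha (a + t • c)
  rw [Fintype.card_option, Fintype.card_fin] at hcard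
  omega

theorem IsPPT.hasProductVector_of_finrank_le_three {S : A →ₗ[ℂ] B →ₗ[ℂ] V} (hS : IsPPT S)
    (h0 : 0 < Module.finrank ℂ V) (h3 : Module.finrank ℂ V ≤ 3)
    (hne : ∃ a f, S a f ≠ 0) : HasProductVector S := by
  have : Nontrivial V := Module.finrank_pos_iff.1 h0
  by_cases hA : ∃ a, Function.Surjective (S a)
  · exact hS.hasProductVector_of_surjective hA.choose_spec
  by_cases hB : ∃ b, Function.Surjective (S.flip b)
  · exact (hS.flip.hasProductVector_of_surjective hB.choose_spec).of_flip
  push Not at hA hB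
  have hbdd : ∃ a, ∀ c, Module.finrank ℂ (S c).range ≤ Module.finrank ℂ (S a).range := by
    have hb : BddAbove (Set.range fun c => Module.finrank ℂ (S c).range) :=
      ⟨_, by rintro _ ⟨c, rfl⟩; exact Submodule.finrank_le _⟩
    obtain ⟨a, ha⟩ := Nat.sSup_mem (Set.range_nonempty _) hb
    exact ⟨a, fun c => (le_csSup hb ⟨c, rfl⟩).trans ha.ge⟩
  obtain ⟨a, ha⟩ := hbdd
  have hker := hS.ker_le_ker ha
  have hr2 : Module.finrank ℂ (S a).range ≤ 2 := by
    have : (S a).range < ⊤ := lt_top_iff_ne_top.2 fun h => hA a (LinearMap.range_eq_top.1 h)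
    have := Submodule.finrank_lt this.ne
    omega
  obtain ⟨c₀, b, hc₀⟩ := hne
  have hb : S a b ≠ 0 := fun h => hc₀ (hker c₀ h)
  -- Pairing with this `x` kills `b` and the common kernel; what is left of `B` has dimension at
  -- most one, so the pairing has rank at most one.
  obtain ⟨x, hx, hxb⟩ : ∃ x : V, x ≠ 0 ∧ ∀ c, ⟪x, S c b⟫_ℂ = 0 := by
    have hbot : (S.flip b).rangeᗮ ≠ ⊥ := fun h =>
      hB b (LinearMap.range_eq_top.1 ((Submodule.orthogonal_eq_bot_iff).1 h))
    obtain ⟨x, hx, hx0⟩ := Submodule.exists_mem_ne_zero_of_ne_bot hbot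
    refine ⟨x, hx0, fun c => ?_⟩
    exact (Submodule.mem_orthogonal' _ _).1 hx _ ⟨c, rfl⟩
  refine ⟨x, hx, ?_⟩
  obtain ⟨g, hg⟩ : ∃ g, ∀ f, ∃ α β : ℂ, S a f = α • S a b + β • S a g := by
    have hlt : Module.finrank ℂ ((S a).range ⧸ ((ℂ ∙ (⟨S a b, b, rfl⟩ : (S a).range)))) ≤ 1 := by
      have h1 := Submodule.finrank_quotient_add_finrank
        (ℂ ∙ (⟨S a b, b, rfl⟩ : (S a).range))
      rw [finrank_span_singleton (by simpa [Subtype.ext_iff] using hb)] at h1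
      omega
    obtain ⟨v, hv⟩ := finrank_le_one_iff.1 hlt
    obtain ⟨⟨_, g, rfl⟩, rfl⟩ := Submodule.Quotient.mk_surjective _ v
    refine ⟨g, fun f => ?_⟩
    obtain ⟨β, hβ⟩ := hv (Submodule.Quotient.mk ⟨S a f, f, rfl⟩)
    rw [← Submodule.Quotient.mk_smul, eq_comm, Submodule.Quotient.eq,
      Submodule.mem_span_singleton] at hβ
    obtain ⟨α, hα⟩ := hβ
    refine ⟨α, β, ?_⟩
    have := congrArg Subtype.val hα
    simp only [Submodule.coe_smul, Submodule.coe_sub] at this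
    rw [this]; abel
  have hform : ∀ f, ∃ β : ℂ, ∀ c, ⟪x, S c f⟫_ℂ = β * ⟪x, S c g⟫_ℂ := by
    intro f
    obtain ⟨α, β, h⟩ := hg f
    refine ⟨β, fun c => ?_⟩
    have hk : f - α • b - β • g ∈ (S a).ker := by simp [h]
    have := hker c hk
    rw [LinearMap.mem_ker, map_sub, map_sub, map_smul, map_smul] at this
    have h2 : S c f = α • S c b + β • S c g := by
      rw [sub_sub, sub_eq_zero] at this; exact this
    rw [h2, inner_add_right, inner_smul_right, inner_smul_right, hxb, mul_zero, zero_add]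
  by_cases hz : ∀ c, ⟪x, S c g⟫_ℂ = 0
  · refine ⟨0, 0, fun c f => ?_⟩
    obtain ⟨β, h⟩ := hform f
    simp [h, hz]
  push Not at hz
  obtain ⟨c₁, hc₁⟩ := hz
  refine ⟨(⟪x, S c₁ g⟫_ℂ)⁻¹ • (pairing S x).flip g, pairing S x c₁, fun c f => ?_⟩
  obtain ⟨β, h⟩ := hform f
  rw [LinearMap.smul_apply, LinearMap.flip_apply, pairing_apply, pairing_apply, h, h c₁,
    smul_eq_mul]
  field_simp

end ProductVector

/-! ### The upper bound on the size -/

section UpperBound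

variable {m n : ℕ}

/-- Entrywise complex conjugation. -/
noncomputable def conjVec (a : EuclideanSpace ℂ (Fin m)) : EuclideanSpace ℂ (Fin m) :=
  WithLp.toLp 2 (star a.ofLp)

lemma inner_conjVec (a c : EuclideanSpace ℂ (Fin m)) : ⟪conjVec a, conjVec c⟫_ℂ = ⟪c, a⟫_ℂ := by
  simp [conjVec, PiLp.inner_apply, mul_comm]

/-- Product vectors are orthogonal exactly when one pair of factors is, and conjugation preserves
that. -/
lemma Orthonormal.conjVec_tmul {ι : Type*} {u : ι → EuclideanSpace ℂ (Fin m)}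
    {w : ι → EuclideanSpace ℂ (Fin n)} (h : Orthonormal ℂ (fun i => u i ⊗ₜ[ℂ] w i)) :
    Orthonormal ℂ (fun i => conjVec (u i) ⊗ₜ[ℂ] w i) := by
  classical
  rw [orthonormal_iff_ite] at h ⊢
  intro i j
  have hij := h i j
  rw [TensorProduct.inner_tmul] at hij ⊢
  rw [inner_conjVec]
  split_ifs at hij ⊢ with he
  · subst he; exact hij
  · rcases mul_eq_zero.1 hij with h0 | h0
    · rw [inner_eq_zero_symm.1 h0, zero_mul]
    · rw [h0, mul_zero]

variable {E : Type*} [NormedAddCommGroup E] [InnerProductSpace ℂ E]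

lemma orthonormal_normalize
    (U : Finset E) (h0 : ∀ ψ ∈ U, ψ ≠ 0) (ho : ∀ ψ ∈ U, ∀ φ ∈ U, ψ ≠ φ → ⟪ψ, φ⟫_ℂ = 0) :
    Orthonormal ℂ (fun ψ : U => (‖(ψ : E)‖ : ℂ)⁻¹ • (ψ : E)) := by
  refine ⟨fun ψ => ?_, fun ψ φ hne' => ?_⟩
  · rw [norm_smul, norm_inv, Complex.norm_real, norm_norm]
    exact inv_mul_cancel₀ (norm_ne_zero_iff.2 (h0 ψ ψ.2))
  · simp only [inner_smul_left, inner_smul_right]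
    rw [ho ψ ψ.2 φ φ.2 (fun h => hne' (Subtype.ext h)), mul_zero, mul_zero]

lemma span_range_normalize (U : Finset E) (h0 : ∀ ψ ∈ U, ψ ≠ 0) :
    Submodule.span ℂ (Set.range fun ψ : U => (‖(ψ : E)‖ : ℂ)⁻¹ • (ψ : E)) =
      Submodule.span ℂ (U : Set E) := by
  apply le_antisymm
  · rw [Submodule.span_le]
    rintro _ ⟨ψ, rfl⟩
    exact Submodule.smul_mem _ _ (Submodule.subset_span ψ.2)
  · rw [Submodule.span_le]
    intro ψ hψ
    have hne : (‖ψ‖ : ℂ) ≠ 0 := by exact_mod_cast norm_ne_zero_iff.2 (h0 ψ hψ)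
    have : ψ = (‖ψ‖ : ℂ) • ((‖ψ‖ : ℂ)⁻¹ • ψ) := by
      rw [smul_smul, mul_inv_cancel₀ hne, one_smul]
    rw [this]
    exact Submodule.smul_mem _ _ (Submodule.subset_span ⟨⟨ψ, hψ⟩, rfl⟩)

lemma finrank_span_eq_card_of_orthogonal (U : Finset E) (h0 : ∀ ψ ∈ U, ψ ≠ 0)
    (ho : ∀ ψ ∈ U, ∀ φ ∈ U, ψ ≠ φ → ⟪ψ, φ⟫_ℂ = 0) :
    Module.finrank ℂ (Submodule.span ℂ (U : Set E)) = U.card := by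
  refine finrank_span_finset_eq_card ?_
  exact linearIndependent_of_ne_zero_of_inner_eq_zero (fun ψ => h0 ψ ψ.2)
    (fun ψ φ h => ho ψ ψ.2 φ φ.2 (fun h' => h (Subtype.ext h')))

lemma card_add_finrank_orthogonal [FiniteDimensional ℂ E] (U : Finset E) (h0 : ∀ ψ ∈ U, ψ ≠ 0)
    (ho : ∀ ψ ∈ U, ∀ φ ∈ U, ψ ≠ φ → ⟪ψ, φ⟫_ℂ = 0) :
    U.card + Module.finrank ℂ (Submodule.span ℂ (U : Set E))ᗮ = Module.finrank ℂ E := by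
  rw [← finrank_span_eq_card_of_orthogonal U h0 ho]
  exact Submodule.finrank_add_finrank_orthogonal _

lemma inner_starProjection_orthogonal_span {ι : Type*} [Fintype ι] [FiniteDimensional ℂ E]
    {e : ι → E} (h : Orthonormal ℂ e) (x y : E) :
    ⟪x, (Submodule.span ℂ (Set.range e))ᗮ.starProjection y⟫_ℂ =
      ⟪x, y⟫_ℂ - ∑ i, ⟪x, e i⟫_ℂ * ⟪e i, y⟫_ℂ := by
  have hproj : y - ∑ i, ⟪e i, y⟫_ℂ • e i =
      (Submodule.span ℂ (Set.range e))ᗮ.starProjection y := by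
    refine Submodule.eq_starProjection_of_mem_orthogonal'
      (z := ∑ i, ⟪e i, y⟫_ℂ • e i) ?_ ?_ (sub_add_cancel _ _).symm |>.symm
    · rw [Submodule.mem_orthogonal]
      intro z hz
      induction hz using Submodule.span_induction with
      | mem z hz =>
        obtain ⟨j, rfl⟩ := hz
        rw [inner_sub_right, inner_sum]
        simp only [inner_smul_right]
        classical
        simp [orthonormal_iff_ite.1 h]
      | zero => simp
      | add y z _ _ hy hz => rw [inner_add_left, hy, hz, add_zero]
      | smul t y _ hy => rw [inner_smul_left, hy, mul_zero]
    · refine Submodule.le_orthogonal_orthogonal _ ?_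
      exact Submodule.sum_mem _ fun i _ => Submodule.smul_mem _ _ (Submodule.subset_span ⟨i, rfl⟩)
  rw [← hproj, inner_sub_right, inner_sum]
  simp [inner_smul_right, mul_comm]

lemma Orthonormal.exists_nonneg_eq_inner_sub {ι : Type*} [Fintype ι] {e : ι → E}
    (h : Orthonormal ℂ e) (x : E) :
    ∃ s : ℝ, 0 ≤ s ∧ (s : ℂ) = ⟪x, x⟫_ℂ - ∑ i, ⟪x, e i⟫_ℂ * ⟪e i, x⟫_ℂ := by
  refine ⟨_, sub_nonneg.2 (h.sum_inner_products_le (s := Finset.univ) (x := x)), ?_⟩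
  push_cast
  simp_rw [← Complex.conj_mul', inner_conj_symm]
  rw [inner_self_eq_norm_sq_to_K]
  rfl

lemma ofReal_norm_sq_add_norm_sq_add_re (p q x y : E) :
    ((‖p‖ ^ 2 + ‖q‖ ^ 2 + 2 * (⟪x, y⟫_ℂ).re : ℝ) : ℂ) =
      ⟪p, p⟫_ℂ + ⟪q, q⟫_ℂ + (⟪x, y⟫_ℂ + ⟪y, x⟫_ℂ) := by
  rw [← inner_conj_symm y x, Complex.add_conj, inner_self_eq_norm_sq_to_K,
    inner_self_eq_norm_sq_to_K]
  push_cast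
  rfl

section Bilinear

variable [FiniteDimensional ℂ E]
  (t : EuclideanSpace ℂ (Fin m) →ₗ[ℂ] EuclideanSpace ℂ (Fin n) →ₗ[ℂ] E)

/-- The bilinear map `t` followed by the orthogonal projection onto `W`. -/
noncomputable def projBilin (W : Submodule ℂ E) :
    EuclideanSpace ℂ (Fin m) →ₗ[ℂ] EuclideanSpace ℂ (Fin n) →ₗ[ℂ] W :=
  t.compr₂ W.orthogonalProjectionOnto.toLinearMap

lemma inner_projBilin (W : Submodule ℂ E) (x : W)
    (a : EuclideanSpace ℂ (Fin m)) (b : EuclideanSpace ℂ (Fin n)) :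
    ⟪x, projBilin t W a b⟫_ℂ = ⟪(x : E), t a b⟫_ℂ :=
  Submodule.inner_orthogonalProjectionOnto_eq_of_mem_left x _

lemma inner_projBilin_projBilin (W : Submodule ℂ E)
    (a c : EuclideanSpace ℂ (Fin m)) (f g : EuclideanSpace ℂ (Fin n)) :
    ⟪projBilin t W a f, projBilin t W c g⟫_ℂ = ⟪t a f, W.starProjection (t c g)⟫_ℂ := by
  rw [inner_projBilin]
  exact W.starProjection_isSymmetric (t a f) (t c g)

variable {t}

/-- The required inequality is Bessel's for the conjugated orthonormal system, applied to `conjVec a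
⊗ f + conjVec c ⊗ g`. -/
lemma isPPT_projBilin_orthogonal (ht : ∀ a c f g, ⟪t a f, t c g⟫_ℂ = ⟪a, c⟫_ℂ * ⟪f, g⟫_ℂ)
    {ι : Type*} [Fintype ι] {u : ι → EuclideanSpace ℂ (Fin m)}
    {w : ι → EuclideanSpace ℂ (Fin n)} (h : Orthonormal ℂ (fun i => t (u i) (w i))) :
    IsPPT (projBilin t (Submodule.span ℂ (Set.range fun i => t (u i) (w i)))ᗮ) := by
  intro a c f g
  have h' : Orthonormal ℂ (fun i => u i ⊗ₜ[ℂ] w i) := by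
    classical
    rw [orthonormal_iff_ite] at h ⊢
    intro i j
    rw [TensorProduct.inner_tmul, ← ht, h]
  obtain ⟨s, hs, hb⟩ := h'.conjVec_tmul.exists_nonneg_eq_inner_sub
    (conjVec a ⊗ₜ[ℂ] f + conjVec c ⊗ₜ[ℂ] g)
  suffices heq : ∀ r : ℝ, (r : ℂ) = s → 0 ≤ r by
    refine heq _ ?_
    rw [ofReal_norm_sq_add_norm_sq_add_re, hb]
    simp only [inner_projBilin_projBilin, inner_starProjection_orthogonal_span h, ht]
    simp only [inner_add_left, inner_add_right, TensorProduct.inner_tmul, inner_conjVec]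
    rw [sub_add_sub_comm, sub_add_sub_comm, sub_add_sub_comm, ← Finset.sum_add_distrib,
      ← Finset.sum_add_distrib, ← Finset.sum_add_distrib]
    congr 1
    · ring
    · exact Finset.sum_congr rfl fun i _ => by ring
  intro r hrs
  rwa [Complex.ofReal_injective hrs]

theorem exists_product_mem_orthogonal_of_finrank_le_three
    (ht : ∀ a c f g, ⟪t a f, t c g⟫_ℂ = ⟪a, c⟫_ℂ * ⟪f, g⟫_ℂ)
    (hsep : ∀ x y : E, (∀ a f, ⟪x, t a f⟫_ℂ = ⟪y, t a f⟫_ℂ) → x = y)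
    (U : Finset E) (h0 : ∀ ψ ∈ U, ψ ≠ 0) (hp : ∀ ψ ∈ U, ∃ a b, ψ = t a b)
    (ho : ∀ ψ ∈ U, ∀ φ ∈ U, ψ ≠ φ → ⟪ψ, φ⟫_ℂ = 0)
    (hpos : 0 < Module.finrank ℂ (Submodule.span ℂ (U : Set E))ᗮ)
    (hle : Module.finrank ℂ (Submodule.span ℂ (U : Set E))ᗮ ≤ 3) :
    ∃ x ∈ (Submodule.span ℂ (U : Set E))ᗮ, x ≠ 0 ∧ ∃ a b, x = t a b := by
  choose a b hab using fun ψ : U => hp ψ ψ.2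
  have hval : (fun ψ : U => t ((‖(ψ : E)‖ : ℂ)⁻¹ • a ψ) (b ψ)) =
      fun ψ : U => (‖(ψ : E)‖ : ℂ)⁻¹ • (ψ : E) := by
    ext ψ
    rw [map_smul, LinearMap.smul_apply, ← hab]
  have hppt := isPPT_projBilin_orthogonal ht (hval ▸ orthonormal_normalize U h0 ho)
  rw [hval, span_range_normalize U h0] at hppt
  set W := (Submodule.span ℂ (U : Set E))ᗮ with hW
  have hne : ∃ a f, projBilin t W a f ≠ 0 := by
    by_contra! h
    obtain ⟨x, hx⟩ := Module.finrank_pos_iff_exists_ne_zero.1 hpos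
    refine hx (Subtype.ext (hsep _ _ fun a b => ?_))
    rw [← inner_projBilin, h, inner_zero_right]
    simp
  obtain ⟨x, hx, φ, ψ, h⟩ := hppt.hasProductVector_of_finrank_le_three hpos hle hne
  -- Riesz representatives of the two functionals are the tensor factors of `x`.
  let a := (InnerProductSpace.toDual ℂ _).symm (LinearMap.toContinuousLinearMap φ)
  let b := (InnerProductSpace.toDual ℂ _).symm (LinearMap.toContinuousLinearMap ψ)
  refine ⟨x, x.2, by simpa using hx, a, b, hsep _ _ fun c f => ?_⟩
  rw [← inner_projBilin, h, ht, InnerProductSpace.toDual_symm_apply,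
    InnerProductSpace.toDual_symm_apply]
  rfl

/-- The defining properties of an unextendible product basis, for the tensor product given by a
bilinear map `t` into an arbitrary inner product space. -/
structure IsUPBFor (t : EuclideanSpace ℂ (Fin m) →ₗ[ℂ] EuclideanSpace ℂ (Fin n) →ₗ[ℂ] E)
    (U : Finset E) : Prop where
  ne_zero : ∀ ψ ∈ U, ψ ≠ 0
  product : ∀ ψ ∈ U, ∃ a b, ψ = t a b
  orthogonal : ∀ ψ ∈ U, ∀ φ ∈ U, ψ ≠ φ → ⟪ψ, φ⟫_ℂ = 0
  incomplete : Submodule.span ℂ (U : Set E) ≠ ⊤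
  unextendible : ∀ φ ∈ (Submodule.span ℂ (U : Set E))ᗮ, ¬ (φ ≠ 0 ∧ ∃ a b, φ = t a b)

theorem IsUPBFor.card_le (ht : ∀ a c f g, ⟪t a f, t c g⟫_ℂ = ⟪a, c⟫_ℂ * ⟪f, g⟫_ℂ)
    (hsep : ∀ x y : E, (∀ a f, ⟪x, t a f⟫_ℂ = ⟪y, t a f⟫_ℂ) → x = y) {U : Finset E}
    (hU : IsUPBFor t U) : U.card ≤ Module.finrank ℂ E - 4 := by
  have h1 := card_add_finrank_orthogonal U hU.ne_zero hU.orthogonal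
  have hpos : 0 < Module.finrank ℂ (Submodule.span ℂ (U : Set E))ᗮ :=
    Nat.pos_of_ne_zero fun h => hU.incomplete
      (Submodule.orthogonal_eq_bot_iff.1 (Submodule.finrank_eq_zero.1 h))
  by_contra! hlt
  obtain ⟨x, hx, h⟩ := exists_product_mem_orthogonal_of_finrank_le_three ht hsep
    U hU.ne_zero hU.product hU.orthogonal hpos (by omega)
  exact hU.unextendible x hx h

end Bilinear

/-- The tensor product map of the bipartite space. -/
noncomputable def tensorBilin (m n : ℕ) : EuclideanSpace ℂ (Fin m) →ₗ[ℂ]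
    EuclideanSpace ℂ (Fin n) →ₗ[ℂ] BipartiteSpace m n :=
  (TensorProduct.mkL ℂ (EuclideanSpace ℂ (Fin m)) (EuclideanSpace ℂ (Fin n))).toLinearMap₁₂

lemma isUPB_iff_isUPBFor {U : Finset (BipartiteSpace m n)} :
    IsUPB U ↔ IsUPBFor (tensorBilin m n) U :=
  ⟨fun h => ⟨fun ψ hψ => (h.product ψ hψ).1, fun ψ hψ => (h.product ψ hψ).2, h.orthogonal,
    h.incomplete, h.unextendible⟩, fun h => ⟨fun ψ hψ => ⟨h.ne_zero ψ hψ, h.product ψ hψ⟩,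
    h.orthogonal, h.incomplete, h.unextendible⟩⟩

lemma inner_tensorBilin (a c : EuclideanSpace ℂ (Fin m)) (f g : EuclideanSpace ℂ (Fin n)) :
    ⟪tensorBilin m n a f, tensorBilin m n c g⟫_ℂ = ⟪a, c⟫_ℂ * ⟪f, g⟫_ℂ :=
  TensorProduct.inner_tmul ℂ a c f g

lemma ext_inner_tensorBilin (x y : BipartiteSpace m n)
    (h : ∀ a f, ⟪x, tensorBilin m n a f⟫_ℂ = ⟪y, tensorBilin m n a f⟫_ℂ) : x = y :=
  TensorProduct.ext_iff_inner_right.2 h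

theorem IsUPB.card_le {U : Finset (BipartiteSpace m n)} (hU : IsUPB U) :
    U.card ≤ m * n - 4 := by
  have h2 : Module.finrank ℂ (BipartiteSpace m n) = m * n := by simp
  rw [← h2]
  exact (isUPB_iff_isUPBFor.1 hU).card_le inner_tensorBilin ext_inner_tensorBilin

end UpperBound

/-! ### Vectors constant on tiles -/

section Tiling

variable {E : Type*} [NormedAddCommGroup E] [InnerProductSpace ℂ E]
  {P T : Type*} [Fintype P] (B : OrthonormalBasis P ℂ E) (τ : P → Option T)

/-- The vectors spanned by the differences of two basis vectors in the tile `s`. -/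
def tileDiff (s : T) : Submodule ℂ E :=
  Submodule.span ℂ {x | ∃ p q, τ p = some s ∧ τ q = some s ∧ x = B p - B q}

/-- The vectors spanned by the basis vectors outside all tiles. -/
def untiled : Submodule ℂ E :=
  Submodule.span ℂ (Set.range fun p : {p // τ p = none} => B p)

/-- The orthogonal complement of the vectors that are constant on tiles and vanish outside. -/
def tileSpace : Submodule ℂ E :=
  untiled B τ ⊔ ⨆ s, tileDiff B τ s

lemma mem_tileSpace_orthogonal {x : E} : x ∈ (tileSpace B τ)ᗮ ↔
    (∀ p, τ p = none → ⟪B p, x⟫_ℂ = 0) ∧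
    ∀ p q s, τ p = some s → τ q = some s → ⟪B p, x⟫_ℂ = ⟪B q, x⟫_ℂ := by
  have hspan : ∀ S : Set E, x ∈ (Submodule.span ℂ S)ᗮ ↔ ∀ v ∈ S, ⟪v, x⟫_ℂ = 0 := by
    intro S
    refine ⟨fun h v hv => h v (Submodule.subset_span hv), fun h => ?_⟩
    rw [Submodule.mem_orthogonal]
    intro y hy
    induction hy using Submodule.span_induction with
    | mem y hy => exact h y hy
    | zero => simp
    | add y z _ _ hy hz => rw [inner_add_left, hy, hz, add_zero]
    | smul t y _ hy => rw [inner_smul_left, hy, mul_zero]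
  rw [tileSpace, ← Submodule.inf_orthogonal, ← Submodule.iInf_orthogonal, Submodule.mem_inf,
    Submodule.mem_iInf, untiled, hspan]
  simp only [tileDiff, hspan]
  refine and_congr ?_ ?_
  · simp
  · constructor
    · intro h p q s hp hq
      have := h s _ ⟨p, q, hp, hq, rfl⟩
      rwa [inner_sub_left, sub_eq_zero] at this
    · rintro h s _ ⟨p, q, hp, hq, rfl⟩
      rw [inner_sub_left, sub_eq_zero]
      exact h p q s hp hq

lemma tileDiff_isOrtho {s s' : T} (h : s ≠ s') : tileDiff B τ s ⟂ tileDiff B τ s' := by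
  classical
  rw [tileDiff, tileDiff, Submodule.isOrtho_span]
  rintro _ ⟨p, q, hp, hq, rfl⟩ _ ⟨p', q', hp', hq', rfl⟩
  have hne : ∀ a b, τ a = some s → τ b = some s' → ⟪B a, B b⟫_ℂ = 0 := by
    intro a b ha hb
    refine B.orthonormal.2 ?_
    rintro rfl
    exact h (Option.some.inj (ha.symm.trans hb))
  simp [inner_sub_left, inner_sub_right, *]

lemma untiled_isOrtho (s : T) : untiled B τ ⟂ tileDiff B τ s := by
  rw [untiled, tileDiff, Submodule.isOrtho_span]
  rintro _ ⟨⟨a, ha⟩, rfl⟩ _ ⟨p, q, hp, hq, rfl⟩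
  have hne : ∀ b, τ b = some s → ⟪B a, B b⟫_ℂ = 0 := by
    intro b hb
    refine B.orthonormal.2 ?_
    rintro rfl
    simp [ha] at hb
  simp [inner_sub_right, *]

/-- The vector whose coordinate on the tile `s` is `y s`. -/
noncomputable def tileVec (y : T → ℂ) : E := ∑ p, (τ p).elim 0 y • B p

lemma inner_tileVec (y : T → ℂ) (p : P) : ⟪B p, tileVec B τ y⟫_ℂ = (τ p).elim 0 y := by
  classical
  simp [tileVec, orthonormal_iff_ite.1 B.orthonormal]

lemma tileVec_mem (y : T → ℂ) : tileVec B τ y ∈ (tileSpace B τ)ᗮ := by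
  rw [mem_tileSpace_orthogonal]
  simp only [inner_tileVec]
  refine ⟨fun p hp => by simp [hp], fun p q s hp hq => by simp [hp, hq]⟩

lemma finrank_tileSpace_orthogonal [Fintype T] (hτ : ∀ s, ∃ p, τ p = some s) :
    Module.finrank ℂ (tileSpace B τ)ᗮ = Fintype.card T := by
  choose r hr using hτ
  let f : (tileSpace B τ)ᗮ →ₗ[ℂ] T → ℂ :=
    LinearMap.pi fun s => (innerₛₗ ℂ (B (r s))) ∘ₗ (tileSpace B τ)ᗮ.subtype
  have hf : ∀ x s, f x s = ⟪B (r s), (x : E)⟫_ℂ := fun x s => rfl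
  rw [← Module.finrank_fintype_fun_eq_card ℂ (η := T)]
  refine (LinearEquiv.ofBijective f ⟨?_, ?_⟩).finrank_eq
  · rw [← LinearMap.ker_eq_bot, LinearMap.ker_eq_bot']
    intro x hx
    obtain ⟨h1, h2⟩ := (mem_tileSpace_orthogonal B τ).1 x.2
    refine Subtype.ext (B.repr.injective ?_)
    ext p
    rw [B.repr_apply_apply, Submodule.coe_zero, map_zero, PiLp.zero_apply]
    rcases hp : τ p with _ | s
    · exact h1 p hp
    · rw [h2 p (r s) s hp (hr s), ← hf, hx]; rfl
  · intro y
    refine ⟨⟨tileVec B τ y, tileVec_mem B τ y⟩, ?_⟩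
    ext s
    rw [hf]
    simp [inner_tileVec, hr]

end Tiling

/-! ### From tilings to unextendible product bases -/

section ProductBasis

variable {m n : ℕ} {E : Type*} [NormedAddCommGroup E] [InnerProductSpace ℂ E]
  (t : EuclideanSpace ℂ (Fin m) →ₗ[ℂ] EuclideanSpace ℂ (Fin n) →ₗ[ℂ] E)

/-- The subspace `W` is spanned by finitely many pairwise orthogonal product states. -/
def HasProductBasis (W : Submodule ℂ E) : Prop :=
  ∃ U : Finset E, (∀ ψ ∈ U, ψ ≠ 0) ∧ (∀ ψ ∈ U, ∃ a b, ψ = t a b) ∧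
    (∀ ψ ∈ U, ∀ φ ∈ U, ψ ≠ φ → ⟪ψ, φ⟫_ℂ = 0) ∧ Submodule.span ℂ (U : Set E) = W

variable {t}

lemma HasProductBasis.sup {W₁ W₂ : Submodule ℂ E} (h₁ : HasProductBasis t W₁)
    (h₂ : HasProductBasis t W₂) (h : W₁ ⟂ W₂) : HasProductBasis t (W₁ ⊔ W₂) := by
  classical
  obtain ⟨U₁, a₁, b₁, c₁, rfl⟩ := h₁
  obtain ⟨U₂, a₂, b₂, c₂, rfl⟩ := h₂
  rw [Submodule.isOrtho_span] at h
  refine ⟨U₁ ∪ U₂, ?_, ?_, ?_, by rw [Finset.coe_union, Submodule.span_union]⟩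
  · intro ψ hψ
    exact (Finset.mem_union.1 hψ).elim (a₁ ψ) (a₂ ψ)
  · intro ψ hψ
    exact (Finset.mem_union.1 hψ).elim (b₁ ψ) (b₂ ψ)
  · intro ψ hψ φ hφ hne
    rcases Finset.mem_union.1 hψ with hψ | hψ <;> rcases Finset.mem_union.1 hφ with hφ | hφ
    · exact c₁ ψ hψ φ hφ hne
    · exact h hψ hφ
    · exact inner_eq_zero_symm.1 (h hφ hψ)
    · exact c₂ ψ hψ φ hφ hne

lemma HasProductBasis.iSup {ι : Type*} [Fintype ι] {W : ι → Submodule ℂ E}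
    (h : ∀ i, HasProductBasis t (W i)) (ho : ∀ i j, i ≠ j → W i ⟂ W j) :
    HasProductBasis t (⨆ i, W i) := by
  classical
  choose U a b c hU using h
  refine ⟨Finset.univ.biUnion U, ?_, ?_, ?_, ?_⟩
  · intro ψ hψ
    obtain ⟨i, -, hi⟩ := Finset.mem_biUnion.1 hψ
    exact a i ψ hi
  · intro ψ hψ
    obtain ⟨i, -, hi⟩ := Finset.mem_biUnion.1 hψ
    exact b i ψ hi
  · intro ψ hψ φ hφ hne
    obtain ⟨i, -, hi⟩ := Finset.mem_biUnion.1 hψ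
    obtain ⟨j, -, hj⟩ := Finset.mem_biUnion.1 hφ
    by_cases hij : i = j
    · subst hij
      exact c i ψ hi φ hj hne
    · have := ho i j hij
      rw [← hU, ← hU, Submodule.isOrtho_span] at this
      exact this hi hj
  · simp [Submodule.span_iUnion, hU]

lemma HasProductBasis.span_range {ι : Type*} [Fintype ι] {f : ι → E} (h0 : ∀ i, f i ≠ 0)
    (hp : ∀ i, ∃ a b, f i = t a b) (ho : ∀ i j, i ≠ j → ⟪f i, f j⟫_ℂ = 0) :
    HasProductBasis t (Submodule.span ℂ (Set.range f)) := by
  classical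
  refine ⟨Finset.univ.image f, ?_, ?_, ?_, by simp⟩
  · simpa using h0
  · simpa using hp
  · simp only [Finset.mem_image, Finset.mem_univ, true_and, forall_exists_index,
      forall_apply_eq_imp_iff]
    exact fun i j h => ho i j fun hij => h (congrArg f hij)

lemma tmul_ne_zero (ht : ∀ a c f g, ⟪t a f, t c g⟫_ℂ = ⟪a, c⟫_ℂ * ⟪f, g⟫_ℂ)
    {a : EuclideanSpace ℂ (Fin m)} {b : EuclideanSpace ℂ (Fin n)}
    (ha : a ≠ 0) (hb : b ≠ 0) : t a b ≠ 0 := by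
  intro h
  have := ht a a b b
  rw [h, inner_zero_left, eq_comm, mul_eq_zero] at this
  exact this.elim (inner_self_ne_zero.2 ha).elim (inner_self_ne_zero.2 hb).elim

lemma HasProductBasis.map_left (ht : ∀ a c f g, ⟪t a f, t c g⟫_ℂ = ⟪a, c⟫_ℂ * ⟪f, g⟫_ℂ)
    {a : EuclideanSpace ℂ (Fin m)} (ha : a ≠ 0) (W : Submodule ℂ (EuclideanSpace ℂ (Fin n))) :
    HasProductBasis t (W.map (t a)) := by
  let b := stdOrthonormalBasis ℂ W
  have hW : W = Submodule.span ℂ (Set.range fun i => (b i : EuclideanSpace ℂ (Fin n))) := by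
    have h := congrArg (Submodule.map W.subtype) b.toBasis.span_eq
    rw [Submodule.map_span, ← Set.range_comp, Submodule.map_top, Submodule.range_subtype] at h
    rw [OrthonormalBasis.coe_toBasis] at h
    exact h.symm
  rw [hW, Submodule.map_span, ← Set.range_comp]
  refine HasProductBasis.span_range (fun i => ?_) (fun i => ⟨a, b i, rfl⟩) (fun i j hij => ?_)
  · exact tmul_ne_zero ht ha (by simpa using b.orthonormal.ne_zero i)
  · simp only [Function.comp_apply]
    rw [ht, ← Submodule.coe_inner, b.orthonormal.2 hij, mul_zero]

lemma HasProductBasis.map_right (ht : ∀ a c f g, ⟪t a f, t c g⟫_ℂ = ⟪a, c⟫_ℂ * ⟪f, g⟫_ℂ)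
    {b : EuclideanSpace ℂ (Fin n)} (hb : b ≠ 0) (W : Submodule ℂ (EuclideanSpace ℂ (Fin m))) :
    HasProductBasis t (W.map (t.flip b)) := by
  have ht' : ∀ a c f g, ⟪t.flip a f, t.flip c g⟫_ℂ = ⟪a, c⟫_ℂ * ⟪f, g⟫_ℂ := fun a c f g => by
    rw [LinearMap.flip_apply, LinearMap.flip_apply, ht, mul_comm]
  obtain ⟨U, h1, h2, h3, h4⟩ := HasProductBasis.map_left ht' hb W
  refine ⟨U, h1, fun ψ hψ => ?_, h3, h4⟩
  obtain ⟨x, y, rfl⟩ := h2 ψ hψ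
  exact ⟨y, x, rfl⟩

variable {R C T : Type*} [Fintype R] [Fintype C] [Fintype T]

/-- `hline` turns the zero-sum part of a tile into one fixed factor tensored with a subspace;
`hnone` makes the sum of the tiled cells a product; `hrank` is unextendibility. -/
theorem exists_isUPBFor_of_tiling [FiniteDimensional ℂ E]
    (ht : ∀ a c f g, ⟪t a f, t c g⟫_ℂ = ⟪a, c⟫_ℂ * ⟪f, g⟫_ℂ)
    (eA : OrthonormalBasis R ℂ (EuclideanSpace ℂ (Fin m)))
    (eB : OrthonormalBasis C ℂ (EuclideanSpace ℂ (Fin n)))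
    (B : OrthonormalBasis (R × C) ℂ E) (hB : ∀ p, B p = t (eA p.1) (eB p.2))
    (τ : R × C → Option T) (hτ : ∀ s, ∃ p, τ p = some s)
    (hline : ∀ s, (∃ i, ∀ p, τ p = some s → p.1 = i) ∨ (∃ c, ∀ p, τ p = some s → p.2 = c))
    (hnone : ∀ i c c', τ (i, c) = none → τ (i, c') = none) (hT : 2 ≤ Fintype.card T)
    (hrank : ∀ (α : R → ℂ) (β : C → ℂ), (∀ i c, τ (i, c) = none → α i * β c = 0) →
      (∀ p q s, τ p = some s → τ q = some s → α p.1 * β p.2 = α q.1 * β q.2) →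
      (∑ i, α i) * (∑ c, β c) = 0 → ∀ i c, α i * β c = 0) :
    ∃ U : Finset E, IsUPBFor t U ∧ U.card = Module.finrank ℂ E + 1 - Fintype.card T := by
  classical
  have hdiff : ∀ s, HasProductBasis t (tileDiff B τ s) := by
    intro s
    rcases hline s with ⟨i, hi⟩ | ⟨c, hc⟩
    · have : tileDiff B τ s = Submodule.map (t (eA i)) (Submodule.span ℂ
          {x | ∃ c d, τ (i, c) = some s ∧ τ (i, d) = some s ∧ x = eB c - eB d}) := by
        rw [tileDiff, Submodule.map_span]
        congr 1
        ext x
        constructor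
        · rintro ⟨⟨p, c⟩, ⟨q, d⟩, hp, hq, rfl⟩
          obtain rfl : p = i := hi _ hp
          obtain rfl : q = p := hi _ hq
          exact ⟨_, ⟨c, d, hp, hq, rfl⟩, by simp [hB]⟩
        · rintro ⟨_, ⟨c, d, hp, hq, rfl⟩, rfl⟩
          exact ⟨_, _, hp, hq, by simp [hB]⟩
      rw [this]
      exact HasProductBasis.map_left ht (eA.orthonormal.ne_zero i) _
    · have : tileDiff B τ s = Submodule.map (t.flip (eB c)) (Submodule.span ℂ
          {x | ∃ i j, τ (i, c) = some s ∧ τ (j, c) = some s ∧ x = eA i - eA j}) := by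
        rw [tileDiff, Submodule.map_span]
        congr 1
        ext x
        constructor
        · rintro ⟨⟨i, p⟩, ⟨j, q⟩, hp, hq, rfl⟩
          obtain rfl : p = c := hc _ hp
          obtain rfl : q = p := hc _ hq
          exact ⟨_, ⟨i, j, hp, hq, rfl⟩, by simp [hB]⟩
        · rintro ⟨_, ⟨c, d, hp, hq, rfl⟩, rfl⟩
          exact ⟨_, _, hp, hq, by simp [hB]⟩
      rw [this]
      exact HasProductBasis.map_right ht (eB.orthonormal.ne_zero c) _
  have huntiled : HasProductBasis t (untiled B τ) :=
    HasProductBasis.span_range (fun p => B.orthonormal.ne_zero p) (fun p => ⟨_, _, hB p⟩)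
      (fun p q hpq => B.orthonormal.2 fun h => hpq (Subtype.ext h))
  obtain ⟨U, h0, hp, ho, hspan⟩ : HasProductBasis t (tileSpace B τ) :=
    huntiled.sup (HasProductBasis.iSup hdiff fun _ _ h => tileDiff_isOrtho B τ h)
      (Submodule.isOrtho_iSup_right.2 fun s => untiled_isOrtho B τ s)
  set w := tileVec B τ 1 with hw
  have hwU : ∀ ψ ∈ U, ⟪ψ, w⟫_ℂ = 0 := fun ψ hψ =>
    tileVec_mem B τ 1 ψ (hspan ▸ Submodule.subset_span hψ)
  have hw0 : w ≠ 0 := by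
    intro h
    obtain ⟨s⟩ : Nonempty T := Fintype.card_pos_iff.1 (by omega)
    obtain ⟨p, hp⟩ := hτ s
    have := inner_tileVec B τ 1 p
    rw [← hw, h, hp] at this
    simp at this
  have hwprod : w = t (∑ i, if ∃ c, τ (i, c) = none then 0 else eA i) (∑ c, eB c) := by
    rw [hw, tileVec, Fintype.sum_prod_type, map_sum t, LinearMap.sum_apply]
    refine Finset.sum_congr rfl fun i _ => ?_
    rw [map_sum]
    refine Finset.sum_congr rfl fun c _ => ?_
    split_ifs with h
    · obtain ⟨d, hd⟩ := h
      simp [hnone i d c hd]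
    · rcases hs : τ (i, c) with _ | s
      · exact absurd ⟨c, hs⟩ h
      · simp [hB]
  have hwnot : w ∉ U := fun h => hw0 (inner_self_eq_zero.1 (hwU w h))
  have h0' : ∀ ψ ∈ insert w U, ψ ≠ 0 := by
    intro ψ hψ
    rcases Finset.mem_insert.1 hψ with rfl | hψ
    · exact hw0
    · exact h0 ψ hψ
  have ho' : ∀ ψ ∈ insert w U, ∀ φ ∈ insert w U, ψ ≠ φ → ⟪ψ, φ⟫_ℂ = 0 := by
    intro ψ hψ φ hφ hne
    rcases Finset.mem_insert.1 hψ with rfl | hψ <;> rcases Finset.mem_insert.1 hφ with rfl | hφ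
    · exact absurd rfl hne
    · exact inner_eq_zero_symm.1 (hwU φ hφ)
    · exact hwU ψ hψ
    · exact ho ψ hψ φ hφ hne
  have hcardU := card_add_finrank_orthogonal U h0 ho
  rw [hspan, finrank_tileSpace_orthogonal B τ hτ] at hcardU
  have hcardI := card_add_finrank_orthogonal _ h0' ho'
  rw [Finset.card_insert_of_notMem hwnot] at hcardI
  refine ⟨insert w U, ⟨h0', ?_, ho', ?_, ?_⟩, ?_⟩
  · intro ψ hψ
    rcases Finset.mem_insert.1 hψ with rfl | hψ
    · exact ⟨_, _, hwprod⟩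
    · exact hp ψ hψ
  · intro htop
    rw [htop, Submodule.top_orthogonal_eq_bot, finrank_bot] at hcardI
    omega
  · rintro x hx ⟨hx0, a, b, rfl⟩
    have hxw : ⟪w, t a b⟫_ℂ = 0 := hx w (Submodule.subset_span (by simp))
    have hxU : t a b ∈ (tileSpace B τ)ᗮ := by
      rw [← hspan]
      exact Submodule.orthogonal_le (Submodule.span_mono (by simp)) hx
    obtain ⟨h1, h2⟩ := (mem_tileSpace_orthogonal B τ).1 hxU
    simp only [hB, ht] at h1 h2
    have hsum : (∑ i, ⟪eA i, a⟫_ℂ) * (∑ c, ⟪eB c, b⟫_ℂ) = 0 := by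
      rw [hwprod, ht, sum_inner, sum_inner, Finset.sum_mul] at hxw
      rw [Finset.sum_mul, ← hxw]
      refine Finset.sum_congr rfl fun i _ => ?_
      split_ifs with h
      · obtain ⟨d, hd⟩ := h
        rw [inner_zero_left, zero_mul, Finset.mul_sum]
        exact Finset.sum_eq_zero fun c _ => h1 (i, c) (hnone i d c hd)
      · rfl
    have h3 := hrank (fun i => ⟪eA i, a⟫_ℂ) (fun c => ⟪eB c, b⟫_ℂ) (fun i c h => h1 (i, c) h) h2 hsum
    refine hx0 (B.repr.injective ?_)
    ext p
    rw [B.repr_apply_apply, map_zero, PiLp.zero_apply, hB, ht]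
    exact h3 p.1 p.2
  · rw [Finset.card_insert_of_notMem hwnot]
    omega

end ProductBasis

theorem exists_isUPB_of_tiling {m n : ℕ} {R C T : Type*} [Fintype R] [Fintype C] [Fintype T]
    (hR : Fintype.card R = m) (hC : Fintype.card C = n)
    (τ : R × C → Option T) (hτ : ∀ s, ∃ p, τ p = some s)
    (hline : ∀ s, (∃ i, ∀ p, τ p = some s → p.1 = i) ∨ (∃ c, ∀ p, τ p = some s → p.2 = c))
    (hnone : ∀ i c c', τ (i, c) = none → τ (i, c') = none) (hT : 2 ≤ Fintype.card T)
    (hrank : ∀ (α : R → ℂ) (β : C → ℂ), (∀ i c, τ (i, c) = none → α i * β c = 0) →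
      (∀ p q s, τ p = some s → τ q = some s → α p.1 * β p.2 = α q.1 * β q.2) →
      (∑ i, α i) * (∑ c, β c) = 0 → ∀ i c, α i * β c = 0) :
    ∃ U : Finset (BipartiteSpace m n), IsUPB U ∧ U.card = m * n + 1 - Fintype.card T := by
  let eA := (EuclideanSpace.basisFun (Fin m) ℂ).reindex (Fintype.equivFinOfCardEq hR).symm
  let eB := (EuclideanSpace.basisFun (Fin n) ℂ).reindex (Fintype.equivFinOfCardEq hC).symm
  obtain ⟨U, hU, hcard⟩ := exists_isUPBFor_of_tiling (t := tensorBilin m n) inner_tensorBilin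
    eA eB (eA.tensorProduct eB) (fun p => OrthonormalBasis.tensorProduct_apply' eA eB p) τ hτ hline
    hnone hT hrank
  have h2 : Module.finrank ℂ (BipartiteSpace m n) = m * n := by simp
  exact ⟨U, isUPB_iff_isUPBFor.2 hU, by rw [hcard, ← h2]⟩

/-! ### Tilings by vertical dominoes -/

section DominoTiling

variable {ι μ δ ν : Type*}

/-- The tiling of the rows `ι` in which the domino of the column `j` covers the rows `d j` and the
remaining cells of each row form one tile. -/
noncomputable def dominoTile (d : δ → Set ι) : (ι ⊕ μ) × (δ ⊕ ν) → Option (ι ⊕ δ)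
  | (Sum.inl i, Sum.inl j) => open Classical in if i ∈ d j then some (Sum.inr j) else some (Sum.inl i)
  | (Sum.inl i, Sum.inr _) => some (Sum.inl i)
  | (Sum.inr _, _) => none

lemma fst_eq_of_dominoTile_eq {d : δ → Set ι} {p : (ι ⊕ μ) × (δ ⊕ ν)} {i : ι}
    (h : dominoTile d p = some (Sum.inl i)) : p.1 = Sum.inl i := by
  obtain ⟨i' | r, j' | v⟩ := p <;> simp only [dominoTile] at h
  · split_ifs at h <;> simp_all
  all_goals simp_all

lemma snd_eq_of_dominoTile_eq {d : δ → Set ι} {p : (ι ⊕ μ) × (δ ⊕ ν)} {j : δ}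
    (h : dominoTile d p = some (Sum.inr j)) : p.2 = Sum.inl j := by
  obtain ⟨i' | r, j' | v⟩ := p <;> simp only [dominoTile] at h
  · split_ifs at h <;> simp_all
  all_goals simp_all

lemma dominoTile_eq_none {d : δ → Set ι} {i : ι ⊕ μ} {c c' : δ ⊕ ν}
    (h : dominoTile d (i, c) = none) : dominoTile d (i, c') = none := by
  obtain i | r := i
  · obtain j | v := c <;> simp only [dominoTile] at h
    · split_ifs at h
    · simp at h
  · rfl

variable (μ) in
-- A nonzero product vector vanishes on the untiled rows, so only its row coordinates `α` and its
-- column coordinates `β`, `γ` matter; on a row with `α i ≠ 0`, constancy on the row tile passes to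
-- the column coordinates.
theorem exists_isUPB_of_dominoes {m n : ℕ} [Fintype ι] [Fintype μ] [Fintype δ] [Fintype ν]
    (hm : Fintype.card ι + Fintype.card μ = m) (hn : Fintype.card δ + Fintype.card ν = n)
    (d : δ → Set ι) (hd : ∀ j, (d j).Nonempty) (hfree : ∀ i, Nonempty ν ∨ ∃ j, i ∉ d j)
    (hcard : 2 ≤ Fintype.card ι + Fintype.card δ)
    (hrank : ∀ (α : ι → ℂ) (β : δ → ℂ) (γ : ν → ℂ),
      (∀ j, ∀ i ∈ d j, ∀ i' ∈ d j, α i * β j = α i' * β j) →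
      (∀ i, α i ≠ 0 → ∀ j j', i ∉ d j → i ∉ d j' → β j = β j') →
      (∀ i, α i ≠ 0 → ∀ j v, i ∉ d j → β j = γ v) →
      (∀ i, α i ≠ 0 → ∀ v v', γ v = γ v') →
      (∃ i, α i ≠ 0) → ((∃ j, β j ≠ 0) ∨ ∃ v, γ v ≠ 0) →
      (∑ i, α i) ≠ 0 ∧ (∑ j, β j) + (∑ v, γ v) ≠ 0) :
    ∃ U : Finset (BipartiteSpace m n), IsUPB U ∧
      U.card = m * n + 1 - (Fintype.card ι + Fintype.card δ) := by
  rw [← Fintype.card_sum] at hm hn hcard ⊢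
  refine exists_isUPB_of_tiling hm hn (dominoTile (μ := μ) (ν := ν) d) ?_ ?_ ?_ hcard ?_
  · rintro (i | j)
    · rcases hfree i with ⟨⟨v⟩⟩ | ⟨j, hj⟩
      · exact ⟨(Sum.inl i, Sum.inr v), rfl⟩
      · exact ⟨(Sum.inl i, Sum.inl j), if_neg hj⟩
    · obtain ⟨i, hi⟩ := hd j
      exact ⟨(Sum.inl i, Sum.inl j), if_pos hi⟩
  · rintro (i | j)
    · exact Or.inl ⟨Sum.inl i, fun p => fst_eq_of_dominoTile_eq⟩
    · exact Or.inr ⟨Sum.inl j, fun p => snd_eq_of_dominoTile_eq⟩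
  · exact fun i c c' => dominoTile_eq_none
  · intro α β h1 h2 h3
    by_contra! hne
    obtain ⟨i, c, hic⟩ := hne
    have hα := left_ne_zero_of_mul hic
    have hβ := right_ne_zero_of_mul hic
    have hμ : ∀ r, α (Sum.inr r) = 0 := fun r =>
      (mul_eq_zero.1 (h1 (Sum.inr r) c rfl)).resolve_right hβ
    have := hrank (fun i => α (Sum.inl i)) (fun j => β (Sum.inl j)) (fun v => β (Sum.inr v))
      (fun j i hi i' hi' => h2 (Sum.inl i, Sum.inl j) (Sum.inl i', Sum.inl j) (Sum.inr j)
        (if_pos hi) (if_pos hi'))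
      (fun i hi j j' hj hj' => mul_left_cancel₀ hi (h2 (Sum.inl i, Sum.inl j)
        (Sum.inl i, Sum.inl j') (Sum.inl i) (if_neg hj) (if_neg hj')))
      (fun i hi j v hj => mul_left_cancel₀ hi (h2 (Sum.inl i, Sum.inl j)
        (Sum.inl i, Sum.inr v) (Sum.inl i) (if_neg hj) rfl))
      (fun i hi v v' => mul_left_cancel₀ hi (h2 (Sum.inl i, Sum.inr v)
        (Sum.inl i, Sum.inr v') (Sum.inl i) rfl rfl))
      (by
        rcases i with i | r
        · exact ⟨i, hα⟩
        · exact absurd (hμ r) hα)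
      (by
        rcases c with j | v
        · exact Or.inl ⟨j, hβ⟩
        · exact Or.inr ⟨v, hβ⟩)
    rw [Fintype.sum_sum_type, Fintype.sum_sum_type] at h3
    simp only [hμ, Finset.sum_const_zero, add_zero] at h3
    exact (mul_ne_zero this.1 this.2) h3

end DominoTiling

/-! ### The star and the cycle -/

lemma sum_eq_card_mul_of_forall_eq {ι : Type*} [Fintype ι] {f : ι → ℂ} {z : ℂ} (h : ∀ i, f i = z) :
    ∑ i, f i = Fintype.card ι * z := by
  simp [h]

lemma natCast_mul_ne_zero {k : ℕ} (hk : 0 < k) {z : ℂ} (hz : z ≠ 0) : (k : ℂ) * z ≠ 0 :=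
  mul_ne_zero (by exact_mod_cast hk.ne') hz

/-- Row `none` is the hub. In every admissible product vector the nonzero `α` coincide, and so do
the nonzero `β` and `γ`, so neither sum can vanish. -/
theorem exists_isUPB_star {m n p : ℕ} (hp : 3 ≤ p) (hm : p ≤ m) (hn : p ≤ n) :
    ∃ U : Finset (BipartiteSpace m n), IsUPB U ∧ U.card = m * n - (2 * p - 2) := by
  obtain ⟨q, rfl⟩ : ∃ q, p = q + 3 := ⟨p - 3, by omega⟩
  suffices hrank : _ from (exists_isUPB_of_dominoes (m := m) (n := n) (ι := Option (Fin (q + 2)))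
    (Fin (m - (q + 3))) (δ := Fin (q + 2)) (ν := Fin (n - (q + 3) + 1))
    (by simp; omega) (by simp; omega) (fun j => {none, some j}) (fun j => ⟨none, by simp⟩)
    (fun i => Or.inl inferInstance) (by simp; omega) hrank).imp fun U h => ⟨h.1, h.2.trans (by
      simp only [Fintype.card_option, Fintype.card_fin]; omega)⟩
  intro α β γ h1 h2 h3 h4 hα hβγ
  have h1' : ∀ j, α none * β j = α (some j) * β j := fun j => h1 j none (by simp) (some j) (by simp)
  have hγ : ∀ v, γ v = γ 0 := fun v => h4 _ hα.choose_spec v 0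
  have hsγ : ∑ v, γ v = ((n - (q + 3) + 1 : ℕ) : ℂ) * γ 0 := by
    rw [sum_eq_card_mul_of_forall_eq hγ, Fintype.card_fin]
  by_cases hs : ∃ i, α (some i) ≠ 0
  · obtain ⟨i, hi⟩ := hs
    have hβ : ∀ l, l ≠ i → β l = γ 0 := fun l hl => h3 (some i) hi l 0 (by simpa using hl.symm)
    obtain ⟨l₀, hl₀⟩ : ∃ l, l ≠ i := exists_ne i
    by_cases h0 : γ 0 = 0
    · have hβi : β i ≠ 0 := by
        intro hβi
        rcases hβγ with ⟨j, hj⟩ | ⟨v, hv⟩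
        · by_cases hji : j = i
          · exact hj (hji ▸ hβi)
          · exact hj ((hβ j hji).trans h0)
        · exact hv ((hγ v).trans h0)
      have hhub : α none = α (some i) := mul_right_cancel₀ hβi (h1' i)
      have hα0 : ∀ l, l ≠ i → α (some l) = 0 := by
        intro l hl
        by_contra hne
        exact hβi ((h3 (some l) hne i 0 (by simpa using hl)).trans h0)
      rw [Fintype.sum_option, Fintype.sum_eq_single i hα0, hhub, hsγ, h0,
        Fintype.sum_eq_single i (fun l hl => (hβ l hl).trans h0)]
      refine ⟨?_, by simpa using hβi⟩
      rw [← two_mul]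
      exact mul_ne_zero two_ne_zero hi
    · have hleaf : ∀ l, l ≠ i → α (some l) = α none := fun l hl =>
        (mul_right_cancel₀ ((hβ l hl).symm ▸ h0) (h1' l)).symm
      by_cases hhub : α none = 0
      · have hβi : β i = 0 := by
          have := h1' i
          rw [hhub, zero_mul, eq_comm] at this
          exact (mul_eq_zero.1 this).resolve_left hi
        rw [Fintype.sum_option, hhub, Fintype.sum_eq_single i
          (fun l hl => (hleaf l hl).trans hhub), hsγ]
        refine ⟨by simpa using hi, ?_⟩
        rw [← Finset.sum_erase (a := i) _ hβi, Finset.sum_congr rfl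
          (fun l hl => hβ l (Finset.ne_of_mem_erase hl)), Finset.sum_const, nsmul_eq_mul,
          ← add_mul, ← Nat.cast_add]
        exact natCast_mul_ne_zero (by omega) h0
      · have hβi : β i = γ 0 :=
          h3 (some l₀) (by rwa [hleaf l₀ hl₀]) i 0 (by simpa using hl₀)
        have hβ' : ∀ l, β l = γ 0 := fun l => by
          by_cases hl : l = i
          · rw [hl, hβi]
          · exact hβ l hl
        have hα' : ∀ l, α l = α none := by
          rintro (_ | l)
          · rfl
          · exact (mul_right_cancel₀ ((hβ' l).symm ▸ h0) (h1' l)).symm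
        rw [sum_eq_card_mul_of_forall_eq hα', sum_eq_card_mul_of_forall_eq hβ', hsγ, ← add_mul,
          ← Nat.cast_add]
        exact ⟨natCast_mul_ne_zero (by simp) hhub, natCast_mul_ne_zero (by simp) h0⟩
  · push Not at hs
    have hhub : α none ≠ 0 := by
      obtain ⟨_ | l, hl⟩ := hα
      · exact hl
      · exact absurd (hs l) hl
    have hβ : ∀ l, β l = 0 := by
      intro l
      have := h1' l
      rw [hs, zero_mul] at this
      exact (mul_eq_zero.1 this).resolve_left hhub
    have h0 : γ 0 ≠ 0 := by
      rcases hβγ with ⟨j, hj⟩ | ⟨v, hv⟩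
      · exact absurd (hβ j) hj
      · rwa [hγ] at hv
    rw [Fintype.sum_option, hsγ, Finset.sum_eq_zero (fun l _ => hs l),
      Finset.sum_eq_zero (fun l _ => hβ l), add_zero, zero_add]
    exact ⟨hhub, natCast_mul_ne_zero (by omega) h0⟩

lemma ZMod.natCast_ne_zero_of_lt {p k : ℕ} (hk : 0 < k) (hkp : k < p) : (k : ZMod p) ≠ 0 := by
  rw [Ne, ZMod.natCast_eq_zero_iff]
  exact fun h => absurd (Nat.le_of_dvd hk h) (by omega)

/-- A domino with `β j ≠ 0` equates neighbouring rows; an active row equates the columns it does not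
share with a domino. `4 ≤ n` guarantees enough such columns: a spare one, or a cycle of length at
least 4. -/
theorem exists_isUPB_cycle {m n p : ℕ} (hp : 3 ≤ p) (hm : p ≤ m) (hn : p ≤ n) (hn4 : 4 ≤ n) :
    ∃ U : Finset (BipartiteSpace m n), IsUPB U ∧ U.card = m * n - (2 * p - 1) := by
  have : NeZero p := ⟨by omega⟩
  have e1 : (1 : ZMod p) ≠ 0 := by exact_mod_cast ZMod.natCast_ne_zero_of_lt (k := 1) one_pos (by omega)
  have e2 : (2 : ZMod p) ≠ 0 := by exact_mod_cast ZMod.natCast_ne_zero_of_lt (k := 2) two_pos (by omega)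
  have hν : Nonempty (Fin (n - p)) ∨ (3 : ZMod p) ≠ 0 := by
    rcases hn.lt_or_eq with h | h
    · exact Or.inl ⟨⟨0, by omega⟩⟩
    · exact Or.inr (by exact_mod_cast ZMod.natCast_ne_zero_of_lt (k := 3) three_pos (by omega))
  have hmem : ∀ i j : ZMod p, i ∉ ({j, j + 1} : Set (ZMod p)) ↔ i - j ≠ 0 ∧ i - j ≠ 1 := by
    intro i j
    simp [sub_eq_iff_eq_add, add_comm]
  suffices hrank : _ from (exists_isUPB_of_dominoes (m := m) (n := n) (ι := ZMod p)
    (Fin (m - p)) (δ := ZMod p) (ν := Fin (n - p))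
    (by simp; omega) (by simp; omega) (fun j => {j, j + 1}) (fun j => ⟨j, by simp⟩)
    (fun i => Or.inr ⟨i - 2, by rw [hmem]; ring_nf; exact ⟨e2, fun h => e1 (by linear_combination h)⟩⟩)
    (by simp only [ZMod.card]; omega) hrank).imp fun U h => ⟨h.1, h.2.trans (by
      simp only [ZMod.card]; omega)⟩
  intro α β γ h1 h2 h3 h4 hα hβγ
  simp only [hmem] at h2 h3
  have h1' : ∀ j, α j * β j = α (j + 1) * β j := fun j => h1 j j (by simp) (j + 1) (by simp)
  have hadj : ∀ j, β j ≠ 0 → α j = α (j + 1) := fun j h => mul_right_cancel₀ h (h1' j)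
  have hK : (∀ i, α i ≠ 0) → ∃ z, (∀ j, β j = z) ∧ ∀ v, γ v = z := by
    intro hall
    rcases hν with ⟨⟨v₀⟩⟩ | e3
    · refine ⟨γ v₀, fun j => h3 (j + 2) (hall _) j v₀ ?_, fun v => h4 0 (hall _) v v₀⟩
      exact ⟨fun h => e2 (by linear_combination h), fun h => e1 (by linear_combination h)⟩
    · have hstep : ∀ j, β (j + 1) = β j := fun j => h2 (j + 3) (hall _) (j + 1) j
        ⟨fun h => e2 (by linear_combination h), fun h => e1 (by linear_combination h)⟩
        ⟨fun h => e3 (by linear_combination h), fun h => e2 (by linear_combination h)⟩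
      have hconst : ∀ k : ℕ, β k = β 0 := by
        intro k
        induction k with
        | zero => simp
        | succ k ih => rw [Nat.cast_succ, hstep, ih]
      refine ⟨β 0, fun j => ?_, fun v => (h3 2 (hall _) 0 v ?_).symm⟩
      · rw [← ZMod.natCast_zmod_val j, hconst]
      · exact ⟨fun h => e2 (by linear_combination h), fun h => e1 (by linear_combination h)⟩
  have hsingle : ∀ j, β j ≠ 0 → (∀ l, l ≠ j → β l = 0) → (∀ v, γ v = 0) →
      (∑ i, α i) ≠ 0 ∧ (∑ j, β j) + (∑ v, γ v) ≠ 0 := by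
    intro j hj hβ hγ
    have hα0 : ∀ l, l ≠ j ∧ l ≠ j + 1 → α l = 0 := by
      rintro l ⟨hl, hl'⟩
      by_contra hne
      have hfree : l - j ≠ 0 ∧ l - j ≠ 1 :=
        ⟨sub_ne_zero.2 hl, fun h => hl' (by linear_combination h)⟩
      rcases hν with ⟨⟨v⟩⟩ | e3
      · exact hj ((h3 l hne j v hfree).trans (hγ v))
      · by_cases hlj : l + 1 = j
        · refine hj ((h2 l hne j (l + 2) hfree ⟨fun h => e2 (by linear_combination -h),
            fun h => e3 (by linear_combination -h)⟩).trans (hβ _ fun h => e1 ?_))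
          linear_combination h - hlj
        · exact hj ((h2 l hne j (l + 1) hfree ⟨fun h => e1 (by linear_combination -h),
            fun h => e2 (by linear_combination -h)⟩).trans (hβ _ hlj))
    have hαj : α j ≠ 0 := by
      intro h
      obtain ⟨l, hl⟩ := hα
      refine hl ?_
      by_cases hlj : l = j
      · rw [hlj, h]
      by_cases hlj' : l = j + 1
      · rw [hlj', ← hadj j hj, h]
      exact hα0 l ⟨hlj, hlj'⟩
    rw [Fintype.sum_eq_add j (j + 1) (fun h => e1 (by linear_combination -h)) hα0, ← hadj j hj,
      ← two_mul, Fintype.sum_eq_single j hβ, Finset.sum_eq_zero (fun v _ => hγ v), add_zero]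
    exact ⟨mul_ne_zero two_ne_zero hαj, hj⟩
  obtain ⟨i, hi⟩ := hα
  -- Split on the common value on the tile of the active row `i`. If it is zero, only the dominoes
  -- `i - 1` and `i` survive, and they cannot both do so.
  by_cases hz : (∀ j, i - j ≠ 0 → i - j ≠ 1 → β j = 0) ∧ ∀ v, γ v = 0
  · obtain ⟨hβ, hγ⟩ := hz
    have hβ' : ∀ l, l ≠ i → l ≠ i - 1 → β l = 0 := fun l hl hl' =>
      hβ l (sub_ne_zero.2 hl.symm) fun h => hl' (by linear_combination -h)
    by_cases hb : β i = 0
    · refine hsingle (i - 1) ?_ ?_ hγ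
      · intro hb'
        rcases hβγ with ⟨l, hl⟩ | ⟨v, hv⟩
        · refine hl ?_
          by_cases hli : l = i
          · rw [hli, hb]
          by_cases hli' : l = i - 1
          · rw [hli', hb']
          exact hβ' l hli hli'
        · exact hv (hγ v)
      · intro l hl
        by_cases hli : l = i
        · rw [hli, hb]
        exact hβ' l hli hl
    · by_cases hb' : β (i - 1) = 0
      · refine hsingle i hb ?_ hγ
        intro l hl
        by_cases hli' : l = i - 1
        · rw [hli', hb']
        exact hβ' l hl hli'
      · exfalso
        have hne : α (i + 1) ≠ 0 := hadj i hb ▸ hi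
        have hfree : i + 1 - (i - 1) ≠ 0 ∧ i + 1 - (i - 1) ≠ 1 :=
          ⟨fun h => e2 (by linear_combination h), fun h => e1 (by linear_combination h)⟩
        rcases hν with ⟨⟨v⟩⟩ | e3
        · exact hb' ((h3 _ hne _ v hfree).trans (hγ v))
        · refine hb' ((h2 _ hne _ (i + 2) hfree ⟨fun h => e1 (by linear_combination -h),
            fun h => e2 (by linear_combination -h)⟩).trans (hβ _ ?_ ?_))
          · exact fun h => e2 (by linear_combination -h)
          · exact fun h => e3 (by linear_combination -h)
  · obtain ⟨z, hz0, hβ, hγ⟩ : ∃ z, z ≠ 0 ∧ (∀ j, i - j ≠ 0 ∧ i - j ≠ 1 → β j = z) ∧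
        ∀ v, γ v = z := by
      by_cases hv : ∃ v, γ v ≠ 0
      · obtain ⟨v, hv⟩ := hv
        exact ⟨γ v, hv, fun j hj => h3 i hi j v hj, fun v' => h4 i hi v' v⟩
      · push Not at hv
        have : ∃ j, (i - j ≠ 0 ∧ i - j ≠ 1) ∧ β j ≠ 0 := by
          by_contra! h
          exact hz ⟨fun j h0 h1 => h j ⟨h0, h1⟩, hv⟩
        obtain ⟨j, hj, hj0⟩ := this
        exact ⟨β j, hj0, fun j' hj' => h2 i hi j' j hj' hj, fun v => (h3 i hi j v hj).symm⟩
    -- All dominoes avoiding row `i` are nonzero and link the other `p - 1` rows into a path.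
    have hchain : ∀ k : ℕ, k + 2 ≤ p → α (i + 1 + k) = α (i + 1) := by
      intro k
      induction k with
      | zero => simp
      | succ k ih =>
        intro hk
        rw [← ih (by omega), Nat.cast_succ, ← add_assoc, ← hadj]
        rw [hβ]
        · exact hz0
        · have n1 := ZMod.natCast_ne_zero_of_lt (p := p) (k := k + 1) (by omega) (by omega)
          have n2 := ZMod.natCast_ne_zero_of_lt (p := p) (k := k + 2) (by omega) (by omega)
          push_cast at n1 n2
          exact ⟨fun h => n1 (by linear_combination -h), fun h => n2 (by linear_combination -h)⟩
    have hrest : ∀ l, l ≠ i → α l = α (i + 1) := by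
      intro l hl
      have hval : ((l - i - 1).val : ZMod p) = l - i - 1 := ZMod.natCast_zmod_val _
      rw [← hchain (l - i - 1).val, hval]
      · congr 1; ring
      · have hlt := ZMod.val_lt (l - i - 1)
        by_contra hcon
        have heq : (l - i - 1).val + 1 = p := by omega
        have := congrArg (Nat.cast (R := ZMod p)) heq
        rw [Nat.cast_succ, hval, ZMod.natCast_self] at this
        exact hl (by linear_combination this)
    by_cases hnext : α (i + 1) = 0
    · have hα0 : ∀ l, l ≠ i → α l = 0 := fun l hl => (hrest l hl).trans hnext
      have hbi : β i = 0 := by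
        have := h1' i
        rw [hnext, zero_mul] at this
        exact (mul_eq_zero.1 this).resolve_left hi
      have hbi' : β (i - 1) = 0 := by
        have := h1' (i - 1)
        rw [sub_add_cancel, hα0 (i - 1) (fun h => e1 (by linear_combination -h)), zero_mul,
          eq_comm] at this
        exact (mul_eq_zero.1 this).resolve_left hi
      rw [Fintype.sum_eq_single i hα0, sum_eq_card_mul_of_forall_eq hγ]
      refine ⟨hi, ?_⟩
      have hsβ : ∑ j, β j = ((Finset.univ.filter fun j => i - j ≠ 0 ∧ i - j ≠ 1).card : ℂ) * z := by
        rw [← nsmul_eq_mul, ← Finset.sum_const, ← Finset.sum_congr rfl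
          (fun j hj => hβ j (Finset.mem_filter.1 hj).2)]
        symm
        refine Finset.sum_filter_of_ne fun j _ hj => ⟨fun h => hj ?_, fun h => hj ?_⟩
        · rw [← sub_eq_zero.1 h, hbi]
        · rw [show j = i - 1 by linear_combination -h, hbi']
      rw [hsβ, ← add_mul, ← Nat.cast_add]
      refine natCast_mul_ne_zero (Nat.add_pos_left (Finset.card_pos.2 ⟨i - 2, ?_⟩) _) hz0
      rw [Finset.mem_filter]
      exact ⟨Finset.mem_univ _, fun h => e2 (by linear_combination h),
        fun h => e1 (by linear_combination h)⟩
    · have hall : ∀ l, α l ≠ 0 := by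
        intro l
        by_cases hl : l = i
        · rwa [hl]
        · rwa [hrest l hl]
      obtain ⟨w, hβw, hγw⟩ := hK hall
      have hw : w ≠ 0 := by
        rcases hβγ with ⟨j, hj⟩ | ⟨v, hv⟩
        · rwa [← hβw j]
        · rwa [← hγw v]
      have hα' : ∀ l, α l = α (i + 1) := by
        intro l
        by_cases hl : l = i
        · rw [hl]; exact hadj i (by rwa [hβw])
        · exact hrest l hl
      rw [sum_eq_card_mul_of_forall_eq hα', sum_eq_card_mul_of_forall_eq hβw,
        sum_eq_card_mul_of_forall_eq hγw, ← add_mul, ← Nat.cast_add, ZMod.card]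
      exact ⟨natCast_mul_ne_zero (by omega) hnext, natCast_mul_ne_zero (by omega) hw⟩

theorem proposition3 :
    (∀ m n k : ℕ, 4 ≤ m → m ≤ n → 4 ≤ k → k ≤ 2 * m - 1 →
      ∃ U : Finset (BipartiteSpace m n), IsUPB U ∧ U.card = m * n - k) ∧
    (∀ m n : ℕ, 3 ≤ m → m ≤ n → IsGreatest (upbSizes m n) (m * n - 4)) := by
  refine ⟨fun m n k hm hmn hk hkm => ?_, fun m n hm hmn => ⟨?_, ?_⟩⟩
  -- With `p = q + 1`, the star has `2p - 2 = 2q` and the cycle `2p - 1 = 2q + 1`; the bound on `k`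
  -- is `p ≤ m`.
  · rcases Nat.even_or_odd' k with ⟨q, rfl | rfl⟩
    · exact exists_isUPB_star (p := q + 1) (by omega) (by omega) (by omega)
    · exact exists_isUPB_cycle (p := q + 1) (by omega) (by omega) (by omega) (by omega)
  · exact exists_isUPB_star (p := 3) le_rfl hm (hm.trans hmn)
  · rintro _ ⟨U, hU, rfl⟩
    exact hU.card_le
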